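/- Let $Z\sim\mathcal N(0,1)$ be independent of the real random variable $X$, let $Y=\sqrt{\mathsf{snr}}\,X+Z$ with $\mathsf{snr}>0$, and write $I(X,\mathsf{snr})=I(X;Y)$. All logarithms (in entropies and mutual informations) are taken to one fixed base $b>1$. The entropy of $X$ is $H(X)=-\sum_x \Pr\{X=x\}\log\Pr\{X=x\}$ if $X$ is discrete and $H(X)=\infty$ otherwise. Define the capacity of the power-constrained Gaussian channel and its entropy-constrained capacity by $$C(\mathsf{snr})=\sup_{\mathbb E[X^2]\le 1} I(X,\mathsf{snr}),\qquad C_H(h,\mathsf{snr})=\sup_{\mathbb E[X^2]\le 1,\ H(X)\le h} I(X,\mathsf{snr})\qquad (h>0),$$ the suprema being over all distributions of $X$ on $\mathbb R$, and let $h_2(x)=-x\log x-(1-x)\log(1-x)$ be the binary entropy function. Then both capacities are finite, and for every $h$ with $0<h<h_2(1/3)$ (where $h_2(1/3)\approx 0.92$ bits), $$C(\mathsf{snr})-C_H(h,\mathsf{snr})=O(\mathsf{snr}^4)\qquad\text{as }\mathsf{snr}\to 0^+ ,$$ where the implied constant may depend on $h$ and $b$. -/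

import Mathlib

open MeasureTheory ProbabilityTheory
open scoped ENNReal Topology Asymptotics

noncomputable section

namespace GaussianChannel

/-- Base-`b` binary entropy function `h₂(x) = -x log_b x - (1 - x) log_b (1 - x)`. -/
def binaryEntropy (b x : ℝ) : ℝ :=
  -x * Real.logb b x - (1 - x) * Real.logb b (1 - x)

/-- A law on `ℝ` is discrete if it is carried by a countable set. -/
def IsDiscreteLaw (μ : Measure ℝ) : Prop :=
  ∃ s : Set ℝ, s.Countable ∧ μ sᶜ = 0

open scoped Classical in
/-- Base-`b` Shannon entropy `H(X)` of a real random variable `X` with law `μ`: the sum of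
`-p log_b p` over the atoms if the law is discrete (points that are not atoms contribute `0`),
and `∞` otherwise. -/
def entropy (b : ℝ) (μ : Measure ℝ) : ℝ≥0∞ :=
  if IsDiscreteLaw μ then ∑' x : ℝ, ENNReal.ofReal (-μ.real {x} * Real.logb b (μ.real {x}))
  else ∞

/-- Base-`b` mutual information `I(X;Y) = D(P_{XY} ‖ P_X ⊗ P_Y)` of a pair with joint law `ρ`.
`InformationTheory.klDiv` uses natural logarithms. -/
def mutualInfo (b : ℝ) (ρ : Measure (ℝ × ℝ)) : ℝ≥0∞ :=
  InformationTheory.klDiv ρ (ρ.fst.prod ρ.snd) / ENNReal.ofReal (Real.log b)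

/-- Joint law of `(X, Y)` with `Y = √snr X + Z`, where `X` has law `μ` and `Z` is standard
Gaussian and independent of `X`. -/
def channelLaw (μ : Measure ℝ) (snr : ℝ) : Measure (ℝ × ℝ) :=
  (μ.prod (gaussianReal 0 1)).map (fun p => (p.1, √snr * p.1 + p.2))

/-- `I(X, snr)`, for `X` with law `μ`. -/
def channelInfo (b : ℝ) (μ : Measure ℝ) (snr : ℝ) : ℝ≥0∞ :=
  mutualInfo b (channelLaw μ snr)

/-- The power `E[X²]` of `X` with law `μ`. -/
def power (μ : Measure ℝ) : ℝ≥0∞ :=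
  ∫⁻ x, ENNReal.ofReal (x ^ 2) ∂μ

/-- Capacity of the power-constrained Gaussian channel: the supremum of `I(X, snr)` over all
laws of `X` on `ℝ` with `E[X²] ≤ 1`. -/
def capacity (b snr : ℝ) : ℝ≥0∞ :=
  ⨆ (μ : Measure ℝ) (_ : IsProbabilityMeasure μ) (_ : power μ ≤ 1), channelInfo b μ snr

/-- Entropy-constrained capacity: the supremum of `I(X, snr)` over all laws of `X` on `ℝ` with
`E[X²] ≤ 1` and `H(X) ≤ h`. -/
def entropyCapacity (b h snr : ℝ) : ℝ≥0∞ :=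
  ⨆ (μ : Measure ℝ) (_ : IsProbabilityMeasure μ) (_ : power μ ≤ 1)
    (_ : entropy b μ ≤ ENNReal.ofReal h), channelInfo b μ snr

end GaussianChannel

end

/-! ### Divergence identities and the chi-squared bound. -/

namespace InformationTheory

variable {α β : Type*} [MeasurableSpace α] [MeasurableSpace β]

/-! Write `s` for the snr and `Q = N(0, 1 + s)`. The compensation identity `D(P_XY ‖ P_X ⊗ Q) =
D(P_Y ‖ Q) + I(X;Y)` has an explicit left side, at most `log(1 + s)/2` (in nats), with equality at
unit power. Dropping `D(P_Y ‖ Q)` bounds the capacity from above; for a unit-power input, `D(P_Y ‖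
Q)` is exactly the loss against that bound.

The loss is at most the chi-squared divergence, which is `E[M(X, X')] - 1` for an independent copy
`X'` and the Mehler kernel `M` of correlation `ρ = s/(1 + s)`. In the Hermite expansion this is the
sum over `n ≥ 1` of `ρ^n (E He_n(X))² / n!`. A symmetric unit-power input kills `n = 1, 2, 3`,
leaving `O(s^4)`.

The input puts mass `p` on `±1/√p` and the rest at `0`. Its entropy tends to `0` with `p`, so some
fixed `p` meets the entropy constraint. The Hermite series is not used formally: the three-point
second moment is computed in closed form and bounded by elementary inequalities
(`ternarySecondMoment_le`). -/

theorem klDiv_map_measurableEquiv (e : α ≃ᵐ β) (μ ν : Measure α) [IsFiniteMeasure μ]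
    [IsFiniteMeasure ν] : klDiv (μ.map e) (ν.map e) = klDiv μ ν := by
  refine le_antisymm (klDiv_map_le μ ν e.measurable) ?_
  have h := klDiv_map_le (μ.map e) (ν.map e) e.symm.measurable
  simpa [Measure.map_map e.symm.measurable e.measurable] using h

/-- The compensation identity for the divergence from a product measure. -/
theorem klDiv_fst_prod_eq_add [StandardBorelSpace α] [Nonempty α] (P : Measure (α × β))
    [IsProbabilityMeasure P] (Q : Measure β) [IsProbabilityMeasure Q] :
    klDiv P (P.fst.prod Q) = klDiv P.snd Q + klDiv P (P.fst.prod P.snd) := by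
  -- The chain rule for `klDiv` splits off the first coordinate, so the output is swapped into that
  -- place. The conditional term that remains is `key` with `R = P.snd`.
  have key (R : Measure β) [IsProbabilityMeasure R] :
      klDiv P (P.fst.prod R) = klDiv (P.map Prod.swap) (R.prod P.fst) := by
    rw [← klDiv_map_measurableEquiv MeasurableEquiv.prodComm P (P.fst.prod R)]
    congr 1
    exact Measure.prod_swap
  have : IsProbabilityMeasure (P.map Prod.swap) :=
    Measure.isProbabilityMeasure_map measurable_swap.aemeasurable
  have hP : P.snd ⊗ₘ (P.map Prod.swap).condKernel = P.map Prod.swap := by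
    rw [← Measure.fst_map_swap]
    exact (P.map Prod.swap).disintegrate _
  rw [key Q, key P.snd, ← Measure.compProd_const, ← Measure.compProd_const, ← hP,
    klDiv_compProd_eq_add]

theorem klFun_le_sq_sub_one {x : ℝ} (hx : 0 ≤ x) : klFun x ≤ (x - 1) ^ 2 := by
  rw [klFun_apply]
  rcases hx.eq_or_lt with rfl | hx
  · simp
  · nlinarith [Real.log_le_sub_one_of_pos hx]

theorem klDiv_withDensity_add_one_le (ν : Measure α) [IsProbabilityMeasure ν] {f : α → ℝ≥0∞}
    (hf : Measurable f) (hν : IsProbabilityMeasure (ν.withDensity f)) :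
    klDiv (ν.withDensity f) ν + 1 ≤ ∫⁻ x, f x ^ 2 ∂ν := by
  have h1 : ∫⁻ x, f x ∂ν = 1 := by
    rw [← setLIntegral_univ, ← withDensity_apply _ MeasurableSet.univ]
    exact hν.measure_univ
  have h2 : klDiv (ν.withDensity f) ν = ∫⁻ x, ENNReal.ofReal (klFun (f x).toReal) ∂ν := by
    rw [klDiv_eq_lintegral_klFun_of_ac (withDensity_absolutelyContinuous ν f)]
    refine lintegral_congr_ae ?_
    filter_upwards [Measure.rnDeriv_withDensity ν hf] with x hx
    rw [hx]
  -- This is `klFun f ≤ (f - 1)²` integrated, with `2f` moved to the left to avoid truncated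
  -- subtraction; each `f` integrates to `1`.
  have h3 : klDiv (ν.withDensity f) ν + 1 + 1 ≤ ∫⁻ x, f x ^ 2 ∂ν + 1 := by
    calc klDiv (ν.withDensity f) ν + 1 + 1
        = ∫⁻ x, (ENNReal.ofReal (klFun (f x).toReal) + f x + f x) ∂ν := by
          rw [lintegral_add_right _ hf, lintegral_add_right _ hf, h1, h2]
      _ ≤ ∫⁻ x, (f x ^ 2 + 1) ∂ν := by
          refine lintegral_mono fun x => ?_
          rcases eq_or_ne (f x) ∞ with hx | hx
          · simp [hx]
          · have h0 : 0 ≤ (f x).toReal := ENNReal.toReal_nonneg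
            nth_rw 2 3 4 [← ENNReal.ofReal_toReal hx]
            rw [← ENNReal.ofReal_pow h0, ← ENNReal.ofReal_one,
              ← ENNReal.ofReal_add (klFun_nonneg h0) h0,
              ← ENNReal.ofReal_add (add_nonneg (klFun_nonneg h0) h0) h0,
              ← ENNReal.ofReal_add (by positivity) zero_le_one]
            refine ENNReal.ofReal_le_ofReal ?_
            nlinarith [klFun_le_sq_sub_one h0]
      _ = ∫⁻ x, f x ^ 2 ∂ν + 1 := by
          rw [lintegral_add_right _ measurable_const]
          simp
  exact (ENNReal.add_le_add_iff_right ENNReal.one_ne_top).1 h3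

end InformationTheory

/-! ### Likelihood ratios against the Gaussian output. -/

namespace GaussianChannel

/-- The capacity-achieving output law `N(0, 1 + s)`. -/
noncomputable def gaussianOutput (s : ℝ) : Measure ℝ := gaussianReal 0 (1 + s).toNNReal

instance (s : ℝ) : IsProbabilityMeasure (gaussianOutput s) := by
  unfold gaussianOutput; infer_instance

/-- The density of `N(√s x, 1)` with respect to `N(0, 1 + s)`. -/
noncomputable def likelihood (s x y : ℝ) : ℝ :=
  √(1 + s) * Real.exp (-(y - √s * x) ^ 2 / 2 + y ^ 2 / (2 * (1 + s)))

theorem likelihood_pos {s : ℝ} (hs : 0 ≤ s) (x y : ℝ) : 0 < likelihood s x y := by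
  unfold likelihood; positivity

theorem measurable_likelihood (s : ℝ) : Measurable fun p : ℝ × ℝ => likelihood s p.1 p.2 := by
  unfold likelihood; fun_prop

theorem measurable_likelihood_right (s x : ℝ) : Measurable (likelihood s x) := by
  unfold likelihood; fun_prop

theorem measurable_likelihood_left (s y : ℝ) : Measurable fun x => likelihood s x y := by
  unfold likelihood; fun_prop

theorem gaussianOutput_eq_withDensity {s : ℝ} (hs : 0 ≤ s) :
    gaussianOutput s = volume.withDensity (gaussianPDF 0 (1 + s).toNNReal) :=
  gaussianReal_of_var_ne_zero 0 (by simpa using by linarith)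

theorem gaussianPDFReal_mul_likelihood {s : ℝ} (hs : 0 ≤ s) (x y : ℝ) :
    gaussianPDFReal 0 (1 + s).toNNReal y * likelihood s x y = gaussianPDFReal (√s * x) 1 y := by
  have h1 : (0 : ℝ) < 1 + s := by linarith
  have h2 : √(1 + s) ≠ 0 := by positivity
  have h3 : √(2 * Real.pi) ≠ 0 := by positivity
  simp only [gaussianPDFReal, likelihood, Real.coe_toNNReal _ h1.le, NNReal.coe_one, mul_one,
    sub_zero]
  rw [Real.sqrt_mul (by positivity)]
  calc _ = (√(2 * Real.pi))⁻¹ * (Real.exp (-y ^ 2 / (2 * (1 + s))) *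
        Real.exp (-(y - √s * x) ^ 2 / 2 + y ^ 2 / (2 * (1 + s)))) := by field_simp
    _ = _ := by
      rw [← Real.exp_add]
      congr 2
      ring

theorem gaussianReal_eq_withDensity {s : ℝ} (hs : 0 ≤ s) (x : ℝ) :
    gaussianReal (√s * x) 1 =
      (gaussianOutput s).withDensity fun y => ENNReal.ofReal (likelihood s x y) := by
  rw [gaussianOutput_eq_withDensity hs, gaussianReal_of_var_ne_zero _ one_ne_zero,
    ← withDensity_mul _ (measurable_gaussianPDF _ _)
      (measurable_likelihood_right s x).ennreal_ofReal]
  congr 1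
  ext y
  rw [Pi.mul_apply, gaussianPDF, gaussianPDF, ← ENNReal.ofReal_mul (gaussianPDFReal_nonneg _ _ _),
    gaussianPDFReal_mul_likelihood hs]

/-! ### Joint and output laws as densities. -/

variable (μ : Measure ℝ)

theorem channelLaw_fst (s : ℝ) : (channelLaw μ s).fst = μ := by
  rw [channelLaw, Measure.fst_map_prodMk (by fun_prop)]
  exact Measure.fst_prod

theorem channelLaw_eq_withDensity {s : ℝ} (hs : 0 ≤ s) :
    channelLaw μ s = (μ.prod (gaussianOutput s)).withDensity
      fun p => ENNReal.ofReal (likelihood s p.1 p.2) := by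
  ext A hA
  have hm : Measurable fun p : ℝ × ℝ => (p.1, √s * p.1 + p.2) := by fun_prop
  rw [channelLaw, Measure.map_apply hm hA, Measure.prod_apply (hm hA), withDensity_apply _ hA,
    ← lintegral_indicator hA, lintegral_prod _
      ((measurable_likelihood s).ennreal_ofReal.indicator hA).aemeasurable]
  refine lintegral_congr fun x => ?_
  have hx : MeasurableSet (Prod.mk x ⁻¹' A) := measurable_prodMk_left hA
  have h1 : Prod.mk x ⁻¹' ((fun p : ℝ × ℝ => (p.1, √s * p.1 + p.2)) ⁻¹' A) =
      (fun z => √s * x + z) ⁻¹' (Prod.mk x ⁻¹' A) := rfl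
  rw [h1, ← Measure.map_apply (by fun_prop) hx, gaussianReal_map_const_add, zero_add,
    gaussianReal_eq_withDensity hs, withDensity_apply _ hx, ← lintegral_indicator hx]
  rfl

theorem integrable_sq_of_power_ne_top (hμ : power μ ≠ ∞) : Integrable (fun x => x ^ 2) μ :=
  (lintegral_ofReal_ne_top_iff_integrable (by fun_prop) (ae_of_all _ fun x => sq_nonneg x)).1 hμ

theorem toReal_power : (power μ).toReal = ∫ x, x ^ 2 ∂μ :=
  (integral_eq_lintegral_of_nonneg_ae (ae_of_all _ fun x => sq_nonneg x) (by fun_prop)).symm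

variable [IsProbabilityMeasure μ]

instance (s : ℝ) : IsProbabilityMeasure (channelLaw μ s) :=
  Measure.isProbabilityMeasure_map (by fun_prop)

/-- The density of the channel output with respect to `N(0, 1 + s)`. -/
noncomputable def outputDensity (s y : ℝ) : ℝ≥0∞ := ∫⁻ x, ENNReal.ofReal (likelihood s x y) ∂μ

theorem measurable_outputDensity (s : ℝ) : Measurable (outputDensity μ s) :=
  (measurable_likelihood s).ennreal_ofReal.lintegral_prod_left'

theorem channelLaw_snd_eq_withDensity {s : ℝ} (hs : 0 ≤ s) :
    (channelLaw μ s).snd = (gaussianOutput s).withDensity (outputDensity μ s) := by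
  ext A hA
  rw [Measure.snd_apply hA, channelLaw_eq_withDensity μ hs,
    withDensity_apply _ (measurable_snd hA), withDensity_apply _ hA,
    ← lintegral_indicator (measurable_snd hA), lintegral_prod_symm _
      ((measurable_likelihood s).ennreal_ofReal.indicator (measurable_snd hA)).aemeasurable,
    ← lintegral_indicator hA]
  refine lintegral_congr fun y => ?_
  by_cases hy : y ∈ A
  · simp [Set.indicator, hy, outputDensity]
  · simp [Set.indicator, hy]

/-! ### Second moment of the output density. -/

/-- The Mehler kernel, in the parametrization by the signal-to-noise ratio. -/
noncomputable def mehlerKernel (s x x' : ℝ) : ℝ :=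
  (1 + s) / √(1 + 2 * s) *
    Real.exp (s * (2 * (1 + s) * (x * x') - s * (x ^ 2 + x' ^ 2)) / (2 * (1 + 2 * s)))

theorem lintegral_likelihood_mul_likelihood {s : ℝ} (hs : 0 ≤ s) (x x' : ℝ) :
    ∫⁻ y, ENNReal.ofReal (likelihood s x y) * ENNReal.ofReal (likelihood s x' y)
      ∂(gaussianOutput s) = ENNReal.ofReal (mehlerKernel s x x') := by
  have h1 : (0 : ℝ) < 1 + s := by linarith
  have h2 : (0 : ℝ) < 1 + 2 * s := by linarith
  have h3 : √(1 + s) ≠ 0 := by positivity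
  have h4 : √(1 + 2 * s) ≠ 0 := by positivity
  have h5 : √(2 * Real.pi) ≠ 0 := by positivity
  have h0 : 0 ≤ mehlerKernel s x x' := by unfold mehlerKernel; positivity
  -- Reference density times two likelihoods is an unnormalised Gaussian in `y` of precision `1 + 1
  -- - 1/(1 + s) = 1/v`; completing the square leaves the kernel as its mass.
  set v : ℝ := (1 + s) / (1 + 2 * s) with hv
  have hv0 : 0 < v := by positivity
  have hpt (y : ℝ) : gaussianPDFReal 0 (1 + s).toNNReal y * likelihood s x y * likelihood s x' y
      = mehlerKernel s x x' * gaussianPDFReal (v * √s * (x + x')) v.toNNReal y := by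
    rw [gaussianPDFReal_mul_likelihood hs]
    simp only [gaussianPDFReal, likelihood, mehlerKernel, Real.coe_toNNReal _ hv0.le,
      NNReal.coe_one, mul_one]
    rw [Real.sqrt_mul (by positivity : (0 : ℝ) ≤ 2 * Real.pi) v, hv, Real.sqrt_div h1.le]
    have hexp : Real.exp (-(y - √s * x) ^ 2 / 2) *
        Real.exp (-(y - √s * x') ^ 2 / 2 + y ^ 2 / (2 * (1 + s))) =
        Real.exp (s * (2 * (1 + s) * (x * x') - s * (x ^ 2 + x' ^ 2)) / (2 * (1 + 2 * s))) *
        Real.exp (-(y - (1 + s) / (1 + 2 * s) * √s * (x + x')) ^ 2 /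
          (2 * ((1 + s) / (1 + 2 * s)))) := by
      rw [← Real.exp_add, ← Real.exp_add]
      congr 1
      obtain ⟨t, ht, rfl⟩ : ∃ t : ℝ, 0 ≤ t ∧ s = t ^ 2 :=
        ⟨√s, Real.sqrt_nonneg s, (Real.sq_sqrt hs).symm⟩
      rw [Real.sqrt_sq ht]
      field_simp
      ring
    calc _ = (√(2 * Real.pi))⁻¹ * √(1 + s) * (Real.exp (-(y - √s * x) ^ 2 / 2) *
        Real.exp (-(y - √s * x') ^ 2 / 2 + y ^ 2 / (2 * (1 + s)))) := by ring
      _ = _ := by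
        rw [hexp]
        have : (1 + s) / √(1 + 2 * s) = √(1 + s) * (√(1 + s) / √(1 + 2 * s)) := by
          rw [← mul_div_assoc, Real.mul_self_sqrt h1.le]
        rw [this]
        field_simp
  have hL := measurable_likelihood_right s
  rw [gaussianOutput_eq_withDensity hs]
  refine (lintegral_withDensity_eq_lintegral_mul _ (measurable_gaussianPDF _ _)
    ((hL x).ennreal_ofReal.mul (hL x').ennreal_ofReal)).trans ?_
  calc _ = ∫⁻ y, ENNReal.ofReal (mehlerKernel s x x') *
        gaussianPDF (v * √s * (x + x')) v.toNNReal y := by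
        refine lintegral_congr fun y => ?_
        simp only [Pi.mul_apply, gaussianPDF]
        rw [← ENNReal.ofReal_mul h0, ← hpt, ← mul_assoc,
          ← ENNReal.ofReal_mul (gaussianPDFReal_nonneg _ _ _), ← ENNReal.ofReal_mul
          (mul_nonneg (gaussianPDFReal_nonneg _ _ _) (likelihood_pos hs _ _).le)]
    _ = _ := by
        rw [lintegral_const_mul _ (measurable_gaussianPDF _ _),
          lintegral_gaussianPDF_eq_one _ (by simpa using hv0), mul_one]

/-- The square of an average is an average over two independent copies; Tonelli then integrates out
`y`. -/
theorem lintegral_outputDensity_sq {s : ℝ} (hs : 0 ≤ s) :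
    ∫⁻ y, outputDensity μ s y ^ 2 ∂(gaussianOutput s) =
      ∫⁻ x, ∫⁻ x', ENNReal.ofReal (mehlerKernel s x x') ∂μ ∂μ := by
  have hm := (measurable_likelihood s).ennreal_ofReal
  have h1 (y : ℝ) : outputDensity μ s y ^ 2 = ∫⁻ x, ENNReal.ofReal (likelihood s x y) *
      outputDensity μ s y ∂μ := by
    rw [lintegral_mul_const _ (measurable_likelihood_left s y).ennreal_ofReal, sq]
    rfl
  simp_rw [h1]
  rw [lintegral_lintegral_swap]
  · refine lintegral_congr fun x => ?_
    have h2 (y : ℝ) : ENNReal.ofReal (likelihood s x y) * outputDensity μ s y =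
        ∫⁻ x', ENNReal.ofReal (likelihood s x y) * ENNReal.ofReal (likelihood s x' y) ∂μ := by
      rw [lintegral_const_mul _ (measurable_likelihood_left s y).ennreal_ofReal]
      rfl
    simp_rw [h2]
    rw [lintegral_lintegral_swap]
    · exact lintegral_congr fun x' => lintegral_likelihood_mul_likelihood hs x x'
    · exact ((hm.comp (measurable_const.prodMk measurable_fst)).mul
        (hm.comp measurable_swap)).aemeasurable
  · exact ((hm.comp measurable_swap).mul
      ((measurable_outputDensity μ s).comp measurable_fst)).aemeasurable

/-! ### Divergence from the Gaussian reference and the capacity upper bound. -/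

theorem integral_sq_gaussianReal_zero_one : ∫ z, z ^ 2 ∂(gaussianReal 0 1) = 1 := by
  have h := variance_id_gaussianReal (μ := 0) (v := 1)
  rw [variance_eq_sub (memLp_id_gaussianReal 2)] at h
  simpa using h

/-- At `y = √s x + z` the log-likelihood is a quadratic polynomial in `x` and `z`. Its cross term
averages to zero since `Z` is centred and independent of `X`, so only the power of the input
matters. -/
theorem klDiv_channelLaw_prod_gaussianOutput {s : ℝ} (hs : 0 ≤ s) (hμ : power μ ≠ ∞) :
    InformationTheory.klDiv (channelLaw μ s) (μ.prod (gaussianOutput s)) =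
      ENNReal.ofReal (Real.log (1 + s) / 2 + s * ((power μ).toReal - 1) / (2 * (1 + s))) := by
  have h1 : (0 : ℝ) < 1 + s := by linarith
  have hX2 := integrable_sq_of_power_ne_top μ hμ
  have hX : Integrable (fun x => x) μ :=
    ((memLp_two_iff_integrable_sq (by fun_prop)).2 hX2).integrable one_le_two
  have hZL : MemLp (fun z : ℝ => z) 2 (gaussianReal 0 1) := memLp_id_gaussianReal 2
  have hZ2 : Integrable (fun z : ℝ => z ^ 2) (gaussianReal 0 1) := hZL.integrable_sq
  have hZ : Integrable (fun z : ℝ => z) (gaussianReal 0 1) := hZL.integrable one_le_two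
  have hac : channelLaw μ s ≪ μ.prod (gaussianOutput s) := by
    rw [channelLaw_eq_withDensity μ hs]
    exact withDensity_absolutelyContinuous _ _
  have hllr : llr (channelLaw μ s) (μ.prod (gaussianOutput s)) =ᵐ[channelLaw μ s]
      fun p => Real.log (likelihood s p.1 p.2) := by
    have h := Measure.rnDeriv_withDensity (μ.prod (gaussianOutput s))
      (measurable_likelihood s).ennreal_ofReal
    rw [← channelLaw_eq_withDensity μ hs] at h
    filter_upwards [hac.ae_le h] with p hp
    rw [llr, hp, ENNReal.toReal_ofReal (likelihood_pos hs _ _).le]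
  have hlog (p : ℝ × ℝ) : Real.log (likelihood s p.1 (√s * p.1 + p.2)) =
      Real.log (1 + s) / 2 - s / (2 * (1 + s)) * p.2 ^ 2 + s / (2 * (1 + s)) * p.1 ^ 2
        + √s / (1 + s) * (p.1 * p.2) := by
    rw [likelihood, Real.log_mul (by positivity) (by positivity), Real.log_exp,
      Real.log_sqrt h1.le]
    obtain ⟨t, ht, rfl⟩ : ∃ t : ℝ, 0 ≤ t ∧ s = t ^ 2 :=
      ⟨√s, Real.sqrt_nonneg s, (Real.sq_sqrt hs).symm⟩
    rw [Real.sqrt_sq ht]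
    field_simp
    ring
  have hm : Measurable fun p : ℝ × ℝ => (p.1, √s * p.1 + p.2) := by fun_prop
  have hmlog : Measurable fun p : ℝ × ℝ => Real.log (likelihood s p.1 p.2) :=
    (measurable_likelihood s).log
  have hi1 : Integrable (fun p : ℝ × ℝ => s / (2 * (1 + s)) * p.2 ^ 2)
      (μ.prod (gaussianReal 0 1)) := (hZ2.comp_snd μ).const_mul _
  have hi2 : Integrable (fun p : ℝ × ℝ => s / (2 * (1 + s)) * p.1 ^ 2)
      (μ.prod (gaussianReal 0 1)) := (hX2.comp_fst _).const_mul _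
  have hi3 : Integrable (fun p : ℝ × ℝ => √s / (1 + s) * (p.1 * p.2))
      (μ.prod (gaussianReal 0 1)) := (hX.mul_prod hZ).const_mul _
  have hi0 : Integrable (fun _ : ℝ × ℝ => Real.log (1 + s) / 2) (μ.prod (gaussianReal 0 1)) :=
    integrable_const _
  have hint : Integrable (fun p => Real.log (likelihood s p.1 p.2)) (channelLaw μ s) := by
    rw [channelLaw, integrable_map_measure hmlog.aestronglyMeasurable hm.aemeasurable]
    refine (((hi0.sub hi1).add hi2).add hi3).congr (ae_of_all _ fun p => ?_)
    exact (hlog p).symm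
  rw [InformationTheory.klDiv_of_ac_of_integrable hac (hint.congr hllr.symm),
    integral_congr_ae hllr]
  have hval : ∫ p, Real.log (likelihood s p.1 p.2) ∂(channelLaw μ s) =
      Real.log (1 + s) / 2 - s / (2 * (1 + s)) + s / (2 * (1 + s)) * (power μ).toReal := by
    rw [channelLaw, integral_map hm.aemeasurable hmlog.aestronglyMeasurable]
    simp only [hlog]
    have e1 := integral_add ((hi0.sub hi1).add hi2) hi3
    have e2 := integral_add (hi0.sub hi1) hi2
    simp only [Pi.add_apply, Pi.sub_apply] at e1 e2
    rw [e1, e2, integral_sub hi0 hi1, integral_const_mul, integral_const_mul, integral_const_mul,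
      integral_prod_mul (fun x : ℝ => x) (fun z : ℝ => z),
      integral_fun_snd (fun z : ℝ => z ^ 2), integral_fun_fst (fun x : ℝ => x ^ 2),
      integral_sq_gaussianReal_zero_one, toReal_power, integral_id_gaussianReal]
    simp
  rw [hval]
  congr 1
  simp only [probReal_univ]
  field_simp
  ring

theorem klDiv_channelLaw_prod_le {μ : Measure ℝ} [IsProbabilityMeasure μ] (hμ : power μ ≤ 1)
    {s : ℝ} (hs : 0 ≤ s) :
    InformationTheory.klDiv (channelLaw μ s) (μ.prod (gaussianOutput s)) ≤
      ENNReal.ofReal (Real.log (1 + s) / 2) := by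
  rw [klDiv_channelLaw_prod_gaussianOutput μ hs (hμ.trans_lt ENNReal.one_lt_top).ne]
  refine ENNReal.ofReal_le_ofReal ?_
  have h1 : (power μ).toReal ≤ 1 := ENNReal.toReal_le_of_le_ofReal zero_le_one (by simpa using hμ)
  have h2 : s * ((power μ).toReal - 1) / (2 * (1 + s)) ≤ 0 :=
    div_nonpos_of_nonpos_of_nonneg (mul_nonpos_of_nonneg_of_nonpos hs (by linarith))
      (by linarith)
  linarith

theorem capacity_le (b : ℝ) {s : ℝ} (hs : 0 ≤ s) :
    capacity b s ≤ ENNReal.ofReal (Real.log (1 + s) / 2) / ENNReal.ofReal (Real.log b) := by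
  refine iSup_le fun μ => iSup_le fun _ => iSup_le fun hμ => ?_
  rw [channelInfo, mutualInfo]
  refine ENNReal.div_le_div_right ?_ _
  refine le_trans ?_ (klDiv_channelLaw_prod_le hμ hs)
  have h := InformationTheory.klDiv_fst_prod_eq_add (channelLaw μ s) (gaussianOutput s)
  rw [channelLaw_fst] at h ⊢
  rw [h]
  exact le_add_self

theorem entropyCapacity_le_capacity (b h s : ℝ) : entropyCapacity b h s ≤ capacity b s :=
  iSup_mono fun _ => iSup_mono fun _ => iSup_mono fun _ => iSup_le fun _ => le_rfl

/-! ### Three-point inputs of small entropy. -/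

/-- The symmetric three-point law with unit power that puts mass `p` away from the origin. -/
noncomputable def ternaryLaw (p : ℝ) : Measure ℝ :=
  ENNReal.ofReal (1 - p) • Measure.dirac 0 +
    (ENNReal.ofReal (p / 2) • Measure.dirac (1 / √p) +
      ENNReal.ofReal (p / 2) • Measure.dirac (-(1 / √p)))

variable {p : ℝ}

theorem isProbabilityMeasure_ternaryLaw (h0 : 0 ≤ p) (h1 : p ≤ 1) :
    IsProbabilityMeasure (ternaryLaw p) := by
  refine ⟨?_⟩
  simp only [ternaryLaw, Measure.add_apply, Measure.smul_apply, measure_univ, smul_eq_mul, mul_one]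
  rw [← ENNReal.ofReal_add (by linarith) (by linarith), ← ENNReal.ofReal_add (by linarith)
    (by linarith)]
  simp

theorem lintegral_ternaryLaw (f : ℝ → ℝ≥0∞) :
    ∫⁻ x, f x ∂(ternaryLaw p) = ENNReal.ofReal (1 - p) * f 0 +
      (ENNReal.ofReal (p / 2) * f (1 / √p) + ENNReal.ofReal (p / 2) * f (-(1 / √p))) := by
  simp [ternaryLaw, lintegral_add_measure, lintegral_smul_measure]

theorem lintegral_ofReal_ternaryLaw (h0 : 0 ≤ p) (h1 : p ≤ 1) {f : ℝ → ℝ} (hf : ∀ x, 0 ≤ f x) :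
    ∫⁻ x, ENNReal.ofReal (f x) ∂(ternaryLaw p) =
      ENNReal.ofReal ((1 - p) * f 0 + (p / 2 * f (1 / √p) + p / 2 * f (-(1 / √p)))) := by
  have h2 : 0 ≤ 1 - p := by linarith
  have h3 : 0 ≤ p / 2 := by linarith
  rw [lintegral_ternaryLaw, ← ENNReal.ofReal_mul h2, ← ENNReal.ofReal_mul h3,
    ← ENNReal.ofReal_mul h3, ← ENNReal.ofReal_add (mul_nonneg h3 (hf _)) (mul_nonneg h3 (hf _)),
    ← ENNReal.ofReal_add (mul_nonneg h2 (hf _))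
      (add_nonneg (mul_nonneg h3 (hf _)) (mul_nonneg h3 (hf _)))]

theorem power_ternaryLaw (h0 : 0 < p) (h1 : p ≤ 1) : power (ternaryLaw p) = 1 := by
  rw [power, lintegral_ofReal_ternaryLaw h0.le h1 fun x => sq_nonneg x, neg_sq, div_pow,
    Real.sq_sqrt h0.le, ← ENNReal.ofReal_one]
  congr 1
  field_simp
  ring

theorem ternaryLaw_real_singleton (h0 : 0 < p) (h1 : p ≤ 1) (x : ℝ) :
    (ternaryLaw p).real {x} = if x = 0 then 1 - p else
      if x = 1 / √p ∨ x = -(1 / √p) then p / 2 else 0 := by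
  have ha : 0 < 1 / √p := by positivity
  have h2 : 0 ≤ 1 - p := by linarith
  have h3 : 0 ≤ p / 2 := by linarith
  simp only [ternaryLaw, Measure.real, Measure.add_apply, Measure.smul_apply, smul_eq_mul,
    Measure.dirac_apply' _ (measurableSet_singleton x), Set.indicator_apply,
    Set.mem_singleton_iff, Pi.one_apply]
  generalize 1 / √p = a at ha
  by_cases hx0 : x = 0
  · subst hx0
    simp [ha.ne', h2]
  · by_cases hxa : x = a
    · have : ¬ -a = a := by linarith
      subst hxa
      simp [this, Ne.symm hx0, hx0, h3]
    · by_cases hxb : x = -a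
      · have : ¬ a = -a := by linarith
        subst hxb
        simp [this, ha.ne', h3]
      · simp [hx0, hxa, hxb, Ne.symm hx0, Ne.symm hxa, Ne.symm hxb]

theorem isDiscreteLaw_ternaryLaw (p : ℝ) : IsDiscreteLaw (ternaryLaw p) := by
  refine ⟨{0, 1 / √p, -(1 / √p)}, Set.to_countable _, ?_⟩
  simp [ternaryLaw]

theorem entropy_ternaryLaw_le (b : ℝ) (h0 : 0 < p) (h1 : p ≤ 1) :
    entropy b (ternaryLaw p) ≤ ENNReal.ofReal (-(1 - p) * Real.logb b (1 - p)) +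
      2 * ENNReal.ofReal (-(p / 2) * Real.logb b (p / 2)) := by
  classical
  have ha : 0 < 1 / √p := by positivity
  rw [entropy, if_pos (isDiscreteLaw_ternaryLaw p)]
  simp_rw [ternaryLaw_real_singleton h0 h1]
  generalize 1 / √p = a at ha
  rw [tsum_eq_sum (s := {0, a, -a})]
  · rw [Finset.sum_insert, Finset.sum_pair (by linarith), two_mul]
    · simp [ha.ne']
    · simp [ha.ne, ha.ne']
  · intro x hx
    simp only [Finset.mem_insert, Finset.mem_singleton, not_or] at hx
    simp [hx]

/-- As `p → 0` the masses tend to `1, 0, 0`, where `negMulLog` vanishes continuously. -/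
theorem exists_entropy_ternaryLaw_le {b h : ℝ} (hb : 1 < b) (h_pos : 0 < h) :
    ∃ p : ℝ, 0 < p ∧ p ≤ 1 ∧ entropy b (ternaryLaw p) ≤ ENNReal.ofReal h := by
  have hlog : 0 < Real.log b := Real.log_pos hb
  let F : ℝ → ℝ := fun p => (Real.negMulLog (1 - p) + 2 * Real.negMulLog (p / 2)) / Real.log b
  have hF : Continuous F := by fun_prop
  have hF0 : F 0 = 0 := by simp [F]
  have hlim : Filter.Tendsto F (𝓝[>] 0) (𝓝 0) := by
    have := hF.tendsto 0
    rw [hF0] at this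
    exact this.mono_left nhdsWithin_le_nhds
  obtain ⟨p, hp1, hp2⟩ := ((hlim.eventually (gt_mem_nhds h_pos)).and
    (Ioo_mem_nhdsGT (zero_lt_one (α := ℝ)))).exists
  refine ⟨p, hp2.1, hp2.2.le, (entropy_ternaryLaw_le b hp2.1 hp2.2.le).trans ?_⟩
  have e (x : ℝ) : -x * Real.logb b x = Real.negMulLog x / Real.log b := by
    rw [Real.logb, Real.negMulLog, mul_div_assoc]
  have n1 := Real.negMulLog_nonneg (x := 1 - p) (by linarith [hp2.2]) (by linarith [hp2.1])
  have n2 := Real.negMulLog_nonneg (x := p / 2) (by linarith [hp2.1]) (by linarith [hp2.2])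
  rw [e, e, two_mul, ← ENNReal.ofReal_add (by positivity) (by positivity),
    ← ENNReal.ofReal_add (by positivity) (by positivity)]
  refine ENNReal.ofReal_le_ofReal (le_of_eq_of_le ?_ hp1.le)
  simp only [F]
  ring

/-! ### Chi-squared estimate for three-point inputs. -/

/-- The second moment of the output density under the three-point input. -/
noncomputable def ternarySecondMoment (p r : ℝ) : ℝ :=
  √(1 + r) * ((1 - p) ^ 2 + 2 * p * (1 - p) * Real.exp (-(r / p) / 2) +
    p ^ 2 * (Real.exp (-(r / p)) * Real.cosh (√(r * (1 + r)) / p)))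

/-- Symmetry pairs opposite exponents into a `cosh`, so the result is even in `ρ = s/(1 + s)` and
depends on `s` only through `ρ²/(1 - ρ²) = s²/(1 + 2s)`. -/
theorem lintegral_outputDensity_ternaryLaw_sq (h0 : 0 < p) (h1 : p ≤ 1) {s : ℝ} (hs : 0 ≤ s) :
    ∫⁻ y, outputDensity (ternaryLaw p) s y ^ 2 ∂(gaussianOutput s) =
      ENNReal.ofReal (ternarySecondMoment p (s ^ 2 / (1 + 2 * s))) := by
  have := isProbabilityMeasure_ternaryLaw h0.le h1
  have hs1 : 0 < 1 + s := by linarith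
  have hs2 : 0 < 1 + 2 * s := by linarith
  have hK (x x' : ℝ) : 0 ≤ mehlerKernel s x x' := by unfold mehlerKernel; positivity
  have h2 : 0 ≤ 1 - p := by linarith
  rw [lintegral_outputDensity_sq _ hs]
  simp_rw [fun x => lintegral_ofReal_ternaryLaw h0.le h1 (hK x)]
  rw [lintegral_ofReal_ternaryLaw h0.le h1 fun x => add_nonneg (mul_nonneg h2 (hK _ _))
    (add_nonneg (mul_nonneg (by linarith) (hK _ _)) (mul_nonneg (by linarith) (hK _ _)))]
  congr 1
  have ha : (1 / √p) ^ 2 = 1 / p := by rw [div_pow, Real.sq_sqrt h0.le, one_pow]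
  generalize 1 / √p = a at ha
  have hr1 : √(1 + s ^ 2 / (1 + 2 * s)) = (1 + s) / √(1 + 2 * s) := by
    rw [show 1 + s ^ 2 / (1 + 2 * s) = (1 + s) ^ 2 / (1 + 2 * s) by field_simp; ring,
      Real.sqrt_div (by positivity), Real.sqrt_sq hs1.le]
  have hr2 : √(s ^ 2 / (1 + 2 * s) * (1 + s ^ 2 / (1 + 2 * s))) = s * (1 + s) / (1 + 2 * s) := by
    rw [show s ^ 2 / (1 + 2 * s) * (1 + s ^ 2 / (1 + 2 * s)) = (s * (1 + s) / (1 + 2 * s)) ^ 2 by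
      field_simp; ring, Real.sqrt_sq (by positivity)]
  have e0 : s * (2 * (1 + s) * (0 * 0) - s * (0 ^ 2 + 0 ^ 2)) / (2 * (1 + 2 * s)) = 0 := by simp
  have e1 : s * (2 * (1 + s) * (a * a) - s * (a ^ 2 + a ^ 2)) / (2 * (1 + 2 * s)) =
      -(s ^ 2 / (1 + 2 * s) / p) + s * (1 + s) / (1 + 2 * s) / p := by
    rw [← sq, ha]; field_simp; ring
  have e2 : s * (-(2 * (1 + s) * (a * a)) - s * (a ^ 2 + a ^ 2)) / (2 * (1 + 2 * s)) =
      -(s ^ 2 / (1 + 2 * s) / p) + -(s * (1 + s) / (1 + 2 * s) / p) := by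
    rw [← sq, ha]; field_simp; ring
  have e3 : s * (-(s * a ^ 2)) / (2 * (1 + 2 * s)) = -(s ^ 2 / (1 + 2 * s) / p) / 2 := by
    rw [ha]; field_simp
  simp only [mehlerKernel, ternarySecondMoment, hr1, hr2, Real.cosh_eq, neg_sq, mul_neg, neg_mul,
    neg_neg, e0, e1, e2]
  simp only [mul_zero, zero_mul, ne_eq, OfNat.ofNat_ne_zero, not_false_eq_true, zero_pow, zero_add,
    add_zero, zero_sub, neg_zero, e3, Real.exp_zero, Real.exp_add]
  ring

/-- The prefactor is at most `1 + r/2` and the bracket at most `1 - r/2 + C r²`, so the linear terms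
cancel. The hypothesis `hr1` keeps the exponents in `[-1, 1]`, where `exp x ≤ 1 + x + x²`. -/
theorem ternarySecondMoment_le {r : ℝ} (h0 : 0 < p) (h1 : p ≤ 1) (hr : 0 ≤ r)
    (hr1 : r * (1 / p + (1 / p) ^ 2) ≤ 1) :
    ternarySecondMoment p r ≤ 1 + (3 / 2 * (1 / p / 2 + (1 + 1 / p) ^ 2)) * r ^ 2 := by
  have hq1 : 1 ≤ 1 / p := by rw [le_div_iff₀ h0]; linarith
  have hpq : p * (1 / p) = 1 := by field_simp
  rw [ternarySecondMoment, div_eq_mul_one_div r p, div_eq_mul_one_div (√(r * (1 + r))) p]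
  generalize 1 / p = q at *
  have hrle : r ≤ 1 := by nlinarith
  have hexp {x : ℝ} (hx : |x| ≤ 1) : Real.exp x ≤ 1 + x + x ^ 2 := by
    linarith [(abs_le.1 (Real.abs_exp_sub_one_sub_id_le hx)).2]
  have hE1 : Real.exp (-(r * q) / 2) ≤ 1 + -(r * q) / 2 + (-(r * q) / 2) ^ 2 :=
    hexp (abs_le.2 ⟨by nlinarith, by nlinarith [mul_nonneg hr (by linarith : 0 ≤ q)]⟩)
  -- The total exponent once `cosh x ≤ exp (x² / 2)` is applied.
  set u : ℝ := -(r * q) + r * (1 + r) * q ^ 2 / 2 with hu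
  have huabs : |u| ≤ r * (q + q ^ 2) :=
    abs_le.2 ⟨by
      rw [hu]
      nlinarith [mul_nonneg hr (sq_nonneg q), mul_nonneg (mul_nonneg hr hr) (sq_nonneg q)], by
      rw [hu]
      nlinarith [mul_nonneg hr (sq_nonneg q), mul_nonneg hr (by linarith : 0 ≤ q),
        mul_nonneg (mul_nonneg hr (sub_nonneg.2 hrle)) (sq_nonneg q)]⟩
  have hE2 : Real.exp (-(r * q)) * Real.cosh (√(r * (1 + r)) * q) ≤ 1 + u + u ^ 2 := by
    calc _ ≤ Real.exp (-(r * q)) * Real.exp ((√(r * (1 + r)) * q) ^ 2 / 2) := by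
          gcongr
          exact Real.cosh_le_exp_half_sq _
      _ = Real.exp u := by
          rw [← Real.exp_add, mul_pow, Real.sq_sqrt (by positivity)]
      _ ≤ _ := hexp (huabs.trans hr1)
  have husq : u ^ 2 ≤ (r * (q + q ^ 2)) ^ 2 := sq_le_sq' (abs_le.1 huabs).1 (abs_le.1 huabs).2
  set C : ℝ := q / 2 + (1 + q) ^ 2 with hC
  have hin : (1 - p) ^ 2 + 2 * p * (1 - p) * Real.exp (-(r * q) / 2) +
      p ^ 2 * (Real.exp (-(r * q)) * Real.cosh (√(r * (1 + r)) * q)) ≤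
      1 - r / 2 + C * r ^ 2 := by
    calc _ ≤ (1 - p) ^ 2 + 2 * p * (1 - p) * (1 + -(r * q) / 2 + (-(r * q) / 2) ^ 2) +
          p ^ 2 * (1 + u + (r * (q + q ^ 2)) ^ 2) := by
          have : 0 ≤ 1 - p := by linarith
          gcongr
          linarith
      _ = 1 - (p * q) * (1 - p) * r + (p * q) * (1 - p) * q / 2 * r ^ 2
          + (-(p * q) * p * r + (p * q) ^ 2 * (r * (1 + r) / 2)
            + (p * q) ^ 2 * (r * (1 + q)) ^ 2) := by
          rw [hu]; ring
      _ = 1 - r / 2 + (C - (p * q) / 2 + 1 / 2) * r ^ 2 := by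
          rw [hC]
          linear_combination (- (1 - p) * r + (1 - p) * q / 2 * r ^ 2 - p * r + (p * q + 1) *
            (r * (1 + r) / 2 + (r * (1 + q)) ^ 2)) * hpq
      _ = _ := by rw [hpq]; ring
  have hC0 : 0 ≤ C := by positivity
  -- The factor `3/2` in the constant is `1 + r/2` at `r ≤ 1`.
  calc _ ≤ (1 + r / 2) * (1 - r / 2 + C * r ^ 2) := by
        refine mul_le_mul (Real.sqrt_one_add_le (by linarith)) hin ?_ (by linarith)
        have : 0 ≤ 1 - p := by linarith
        positivity
    _ ≤ _ := by nlinarith [mul_nonneg (mul_nonneg hC0 (sq_nonneg r)) (sub_nonneg.2 hrle),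
        sq_nonneg r]

/-! ### Loss of the three-point input and conclusion. -/

theorem log_div_two_le_klDiv_add {s : ℝ} (h0 : 0 < p) (h1 : p ≤ 1) (hs : 0 ≤ s) :
    ENNReal.ofReal (Real.log (1 + s) / 2) + 1 ≤
      InformationTheory.klDiv (channelLaw (ternaryLaw p) s)
        ((channelLaw (ternaryLaw p) s).fst.prod (channelLaw (ternaryLaw p) s).snd) +
      ENNReal.ofReal (ternarySecondMoment p (s ^ 2 / (1 + 2 * s))) := by
  have := isProbabilityMeasure_ternaryLaw h0.le h1
  have hpow := power_ternaryLaw h0 h1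
  have hg := InformationTheory.klDiv_fst_prod_eq_add (channelLaw (ternaryLaw p) s)
    (gaussianOutput s)
  have hk := klDiv_channelLaw_prod_gaussianOutput (ternaryLaw p) hs (by simp [hpow])
  simp only [hpow, ENNReal.toReal_one, sub_self, mul_zero, zero_div, add_zero] at hk
  have hsnd := channelLaw_snd_eq_withDensity (ternaryLaw p) hs
  have hchi := InformationTheory.klDiv_withDensity_add_one_le (gaussianOutput s)
    (measurable_outputDensity (ternaryLaw p) s) (hsnd ▸ inferInstance)
  rw [← hsnd, lintegral_outputDensity_ternaryLaw_sq h0 h1 hs] at hchi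
  rw [channelLaw_fst] at hg ⊢
  rw [← hk, hg, add_right_comm, add_comm]
  gcongr

end GaussianChannel

/-- The first two conjuncts say that the capacities are finite, so that `toReal` below is
harmless. -/
theorem theorem1 (b : ℝ) (hb : 1 < b) (h : ℝ) (h_pos : 0 < h)
    (h_lt : h < GaussianChannel.binaryEntropy b (1 / 3)) :
    (∀ snr : ℝ, 0 < snr → GaussianChannel.capacity b snr ≠ ∞) ∧
    (∀ snr : ℝ, 0 < snr → GaussianChannel.entropyCapacity b h snr ≠ ∞) ∧
    (fun snr : ℝ => (GaussianChannel.capacity b snr).toReal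
        - (GaussianChannel.entropyCapacity b h snr).toReal)
      =O[𝓝[>] (0 : ℝ)] (fun snr : ℝ => snr ^ 4) := by
  have hlog : 0 < Real.log b := Real.log_pos hb
  have hC (s : ℝ) (hs : 0 < s) : GaussianChannel.capacity b s ≠ ∞ :=
    ((GaussianChannel.capacity_le b hs.le).trans_lt (ENNReal.div_lt_top ENNReal.ofReal_ne_top
      (by simpa using hlog))).ne
  have hCH (s : ℝ) (hs : 0 < s) : GaussianChannel.entropyCapacity b h s ≠ ∞ :=
    ((GaussianChannel.entropyCapacity_le_capacity b h s).trans_lt (hC s hs).lt_top).ne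
  refine ⟨hC, hCH, ?_⟩
  -- `p` is fixed before `s → 0`, so `K` depends only on `b` and `h`.
  obtain ⟨p, h0, h1, hent⟩ := GaussianChannel.exists_entropy_ternaryLaw_le hb h_pos
  have hprob := GaussianChannel.isProbabilityMeasure_ternaryLaw h0.le h1
  set K : ℝ := 3 / 2 * (1 / p / 2 + (1 + 1 / p) ^ 2) with hK
  have hK0 : 0 ≤ K := by positivity
  -- Since `s²/(1 + 2s) ≤ s²`, this supplies the smallness hypothesis of `ternarySecondMoment_le`.
  have hsmall : ∀ᶠ s : ℝ in 𝓝[>] 0, s ^ 2 * (1 / p + (1 / p) ^ 2) < 1 := by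
    have hc : Continuous fun s : ℝ => s ^ 2 * (1 / p + (1 / p) ^ 2) := by fun_prop
    refine nhdsWithin_le_nhds ((hc.tendsto 0).eventually (gt_mem_nhds ?_))
    simp
  refine Asymptotics.IsBigO.of_bound (K / Real.log b) ?_
  filter_upwards [hsmall, self_mem_nhdsWithin] with s hs1 (hs : 0 < s)
  have hr : s ^ 2 / (1 + 2 * s) ≤ s ^ 2 := div_le_self (sq_nonneg s) (by linarith)
  have hr0 : 0 ≤ s ^ 2 / (1 + 2 * s) := by positivity
  have hM : GaussianChannel.ternarySecondMoment p (s ^ 2 / (1 + 2 * s)) ≤ K * s ^ 4 + 1 := by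
    refine (GaussianChannel.ternarySecondMoment_le h0 h1 hr0 (le_trans ?_ hs1.le)).trans ?_
    · gcongr
    · have : (s ^ 2 / (1 + 2 * s)) ^ 2 ≤ s ^ 4 :=
        (pow_le_pow_left₀ hr0 hr 2).trans_eq (by ring)
      rw [← hK]
      nlinarith
  have hI : ENNReal.ofReal (Real.log (1 + s) / 2) ≤
      InformationTheory.klDiv (GaussianChannel.channelLaw (GaussianChannel.ternaryLaw p) s)
        ((GaussianChannel.channelLaw (GaussianChannel.ternaryLaw p) s).fst.prod
          (GaussianChannel.channelLaw (GaussianChannel.ternaryLaw p) s).snd) +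
      ENNReal.ofReal (K * s ^ 4) := by
    refine (ENNReal.add_le_add_iff_right ENNReal.one_ne_top).1
      ((GaussianChannel.log_div_two_le_klDiv_add h0 h1 hs.le).trans ?_)
    rw [add_assoc, ← ENNReal.ofReal_one, ← ENNReal.ofReal_add (by positivity) zero_le_one]
    gcongr
  have hle : GaussianChannel.capacity b s ≤ GaussianChannel.entropyCapacity b h s +
      ENNReal.ofReal (K / Real.log b * s ^ 4) := by
    refine (GaussianChannel.capacity_le b hs.le).trans
      ((ENNReal.div_le_div_right hI _).trans ?_)
    rw [ENNReal.add_div, ← ENNReal.ofReal_div_of_pos hlog, div_mul_eq_mul_div]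
    gcongr
    exact le_iSup_of_le (GaussianChannel.ternaryLaw p) (le_iSup_of_le hprob (le_iSup_of_le
      (GaussianChannel.power_ternaryLaw h0 h1).le (le_iSup_of_le hent le_rfl)))
  have hle' := ENNReal.toReal_mono (ENNReal.add_ne_top.2 ⟨hCH s hs, ENNReal.ofReal_ne_top⟩) hle
  rw [ENNReal.toReal_add (hCH s hs) ENNReal.ofReal_ne_top,
    ENNReal.toReal_ofReal (by positivity)] at hle'
  have hge := ENNReal.toReal_mono (hC s hs) (GaussianChannel.entropyCapacity_le_capacity b h s)
  rw [Real.norm_of_nonneg (by linarith), Real.norm_of_nonneg (by positivity)]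
  linarith
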